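/- All rings are commutative with unity. A subring $A$ of a ring $B$ is called a retract of $B$ if there is an idempotent ring endomorphism $\pi : B \to B$ with $\pi(B) = A$; such a $\pi$ is called a retraction of $B$ onto $A$. A local ring is equicharacteristic if its characteristic equals that of its residue field. (1) Let $B$ be an equicharacteristic Noetherian regular local ring and let $A$ be a retract of $B$. Then $B$ is faithfully flat over $A$. (2) Let $k$ be a field, let $n \ge 0$, let $A$ be a subring of the polynomial ring $B = k[X_1, \dots, X_n]$, and let $\pi : B \to B$ be a retraction of $B$ onto $A$. Then, for every maximal ideal $\mathfrak{m}$ of $B$ containing $\ker \pi$, the localization $B_{\mathfrak{m}}$ is faithfully flat over $A_{\mathfrak{m} \cap A}$. -/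

import Mathlib

/-- `π` is a retraction of `B` onto the subring `A`: an idempotent ring endomorphism of `B`
with image `A`. -/
structure IsRetraction {B : Type*} [CommRing B] (π : B →+* B) (A : Subring B) : Prop where
  idempotent : π.comp π = π
  range_eq : π.range = A

/-- The subring `A` is a retract of `B`. -/
def IsRetract {B : Type*} [CommRing B] (A : Subring B) : Prop :=
  ∃ π : B →+* B, IsRetraction π A

/-- A local ring is equicharacteristic if it has the same characteristic as its residue field. -/
def IsEquicharacteristic (B : Type*) [CommRing B] [IsLocalRing B] : Prop :=
  ringChar B = ringChar (IsLocalRing.ResidueField B)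

/-! Let `p : B → A` be the retraction, with kernel P, and induct on the embedding dimension of B. If
P = 0, then B ≅ A. Otherwise Nakayama yields y in P outside the square of the maximal ideal. Then
B/yB is again regular, of smaller embedding dimension, and still retracts onto A, so it is flat over
A. Since B is a domain, y is regular and flatness lifts to B. The retraction splits the inclusion,
so Spec B → Spec A is surjective, whence faithfulness. For polynomial rings, ker π ≤ m lets the
retraction pass to the regular local ring at m. -/

open IsLocalRing TensorProduct

namespace IsLocalRing

variable {R : Type*} [CommRing R] [IsLocalRing R] [IsNoetherianRing R]

/-- An element `x` of the maximal ideal outside its square belongs to a minimal generating set. -/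
lemma exists_span_insert_eq_maximalIdeal {x : R} (hx : x ∈ maximalIdeal R)
    (hx' : x ∉ maximalIdeal R ^ 2) :
    ∃ t : Set R, t.Finite ∧ t.ncard + 1 = (maximalIdeal R).spanFinrank ∧
      Ideal.span (insert x t) = maximalIdeal R := by
  set v : CotangentSpace R := (maximalIdeal R).toCotangent ⟨x, hx⟩ with hv
  have hv0 : v ≠ 0 := fun h ↦ hx' (((maximalIdeal R).toCotangent_eq_zero _).mp h)
  obtain ⟨b, -, hvb, hspan, hli⟩ := exists_linearIndepOn_id_extension
    (K := ResidueField R) (s := {v}) (t := Set.univ) (LinearIndepOn.singleton (v := id) hv0)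
    (Set.subset_univ _)
  have hb : Submodule.span (ResidueField R) b = ⊤ :=
    top_le_iff.mp fun y _ ↦ hspan (Set.mem_univ y)
  have hbfin : b.Finite := hli.setFinite
  have hcard : b.ncard = (maximalIdeal R).spanFinrank := by
    rw [spanFinrank_maximalIdeal_eq_finrank_cotangentSpace]
    have := Module.finrank_eq_nat_card_basis (Module.Basis.mk hli (by simp [hb]))
    rw [this, Nat.card_coe_set_eq]
  let g := Function.surjInv (maximalIdeal R).toCotangent_surjective
  have hg : ∀ w, (maximalIdeal R).toCotangent (g w) = w :=
    Function.surjInv_eq (maximalIdeal R).toCotangent_surjective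
  have hvb' : v ∈ b := hvb rfl
  let t : Set R := (fun w ↦ (g w : R)) '' (b \ {v})
  let s : Set (maximalIdeal R) := insert ⟨x, hx⟩ (g '' (b \ {v}))
  have hs : (maximalIdeal R).toCotangent '' s = b := by
    rw [Set.image_insert_eq, ← Set.image_comp, ← hv]
    have : (⇑(maximalIdeal R).toCotangent ∘ g) = id := funext hg
    rw [this, Set.image_id, Set.insert_sdiff_singleton, Set.insert_eq_of_mem hvb']
  have hst : Submodule.span R s = ⊤ := by
    rw [← CotangentSpace.span_image_eq_top_iff, hs, hb]
  refine ⟨t, (hbfin.sdiff).image _, ?_, ?_⟩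
  · rw [← hcard, Set.ncard_image_of_injective]
    · exact Set.ncard_sdiff_singleton_add_one hvb' hbfin
    · intro w w' h
      rw [← hg w, ← hg w', Subtype.ext h]
  · have h := congrArg (Submodule.map (maximalIdeal R).subtype) hst
    rw [Submodule.map_span, Submodule.map_top, Submodule.range_subtype, Set.image_insert_eq,
      ← Set.image_comp] at h
    exact h

lemma map_mk_maximalIdeal {R : Type*} [CommRing R] [IsLocalRing R] (I : Ideal R) [IsLocalRing (R ⧸ I)] :
    (maximalIdeal R).map (Ideal.Quotient.mk I) = maximalIdeal (R ⧸ I) := by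
  have := IsLocalHom.of_surjective (Ideal.Quotient.mk I) Ideal.Quotient.mk_surjective
  refine le_antisymm (map_maximalIdeal_le _) fun y hy ↦ ?_
  obtain ⟨z, rfl⟩ := Ideal.Quotient.mk_surjective y
  exact Ideal.mem_map_of_mem _ fun h ↦ hy (h.map _)

lemma spanFinrank_maximalIdeal_quotient_add_one_le {x : R} (hx : x ∈ maximalIdeal R)
    (hx' : x ∉ maximalIdeal R ^ 2) [IsLocalRing (R ⧸ Ideal.span {x})] :
    (maximalIdeal (R ⧸ Ideal.span {x})).spanFinrank + 1 ≤ (maximalIdeal R).spanFinrank := by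
  obtain ⟨t, htfin, htcard, ht⟩ := exists_span_insert_eq_maximalIdeal hx hx'
  have h : maximalIdeal (R ⧸ Ideal.span {x}) =
      Ideal.span (Ideal.Quotient.mk (Ideal.span {x}) '' t) := by
    have h0 : Ideal.Quotient.mk (Ideal.span {x}) x = 0 :=
      Ideal.Quotient.eq_zero_iff_mem.mpr (Ideal.mem_span_singleton_self x)
    rw [← map_mk_maximalIdeal, ← ht, Ideal.map_span, Set.image_insert_eq, h0,
      Ideal.span_insert_zero]
  rw [← htcard, h]
  gcongr
  exact (Submodule.spanFinrank_span_le_ncard_of_finite (htfin.image _)).trans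
    (Set.ncard_image_le htfin)

end IsLocalRing

namespace IsRegularLocalRing

variable {R : Type*} [CommRing R] [IsRegularLocalRing R]

/-- Killing `x` lowers the embedding dimension by at least one but the Krull dimension by at most
one. -/
lemma quotient_span_singleton {x : R} (hx : x ∈ maximalIdeal R)
    (hx' : x ∉ maximalIdeal R ^ 2) : IsRegularLocalRing (R ⧸ Ideal.span {x}) := by
  have : Nontrivial (R ⧸ Ideal.span {x}) := Ideal.Quotient.nontrivial_iff.mpr fun h ↦
    (maximalIdeal.isMaximal R).ne_top
      (top_le_iff.mp (h ▸ (Ideal.span_singleton_le_iff_mem _).mpr hx))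
  have : IsLocalRing (R ⧸ Ideal.span {x}) := .of_surjective' _ Ideal.Quotient.mk_surjective
  apply of_spanFinrank_maximalIdeal_le
  have h1 := spanFinrank_maximalIdeal_quotient_add_one_le hx hx'
  have h2 : ringKrullDim R ≤ ringKrullDim (R ⧸ Ideal.span {x}) + 1 := by
    rw [← maximalIdeal_height_eq_ringKrullDim]
    exact Ideal.height_le_ringKrullDim_quotient_add_one hx
  rw [← (isRegularLocalRing_iff R).mp ‹_›] at h2
  have h3 : (((maximalIdeal (R ⧸ Ideal.span {x})).spanFinrank : ℕ) : WithBot ℕ∞) + 1 ≤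
      ringKrullDim (R ⧸ Ideal.span {x}) + 1 := le_trans (by exact_mod_cast h1) h2
  exact (WithBot.add_le_add_iff_right' (c := 1) (by decide) (by decide)).mp h3

/-- A regular local ring is an integral domain. -/
theorem isDomain (R : Type*) [CommRing R] [IsRegularLocalRing R] : IsDomain R := by
  induction h : (maximalIdeal R).spanFinrank using Nat.strong_induction_on generalizing R with
  | _ n ih =>
  by_cases hm : maximalIdeal R = ⊥
  · exact (isField_iff_maximalIdeal_eq.mpr hm).isDomain
  have hsq : ¬ maximalIdeal R ≤ maximalIdeal R ^ 2 := fun hle ↦ hm <|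
    Submodule.eq_bot_of_le_smul_of_le_jacobson_bot (maximalIdeal R) _
      (maximalIdeal R).fg_of_isNoetherianRing (by rwa [smul_eq_mul, ← pow_two])
      (maximalIdeal_le_jacobson _)
  have hfin := minimalPrimes.finite_of_isNoetherianRing R
  by_cases hmin : maximalIdeal R ∈ minimalPrimes R
  · have hdim : ringKrullDim R = 0 := by
      rw [← maximalIdeal_height_eq_ringKrullDim, Ideal.height_eq_zero_iff.mpr hmin]
      rfl
    rw [← (isRegularLocalRing_iff R).mp ‹_›] at hdim
    have h0 : (maximalIdeal R).spanFinrank = 0 := by exact_mod_cast hdim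
    exact absurd ((Submodule.spanFinrank_eq_zero_iff_eq_bot
      (maximalIdeal R).fg_of_isNoetherianRing).mp h0) hm
  obtain ⟨x, hx, hx', hxmin⟩ : ∃ x ∈ maximalIdeal R, x ∉ maximalIdeal R ^ 2 ∧
      ∀ p ∈ minimalPrimes R, x ∉ p := by
    by_contra! hcon
    have hcover : (maximalIdeal R : Set R) ⊆
        ⋃ I ∈ (↑(insert (maximalIdeal R ^ 2) hfin.toFinset) : Set (Ideal R)), (id I : Ideal R) := by
      intro x hx
      simp only [Finset.coe_insert, Set.Finite.coe_toFinset, Set.mem_iUnion]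
      by_cases hx' : x ∈ maximalIdeal R ^ 2
      · exact ⟨_, Set.mem_insert _ _, hx'⟩
      · obtain ⟨p, hp, hxp⟩ := hcon x hx hx'
        exact ⟨p, Set.mem_insert_of_mem _ hp, hxp⟩
    -- Prime avoidance tolerates a non-prime member, here the square of the maximal ideal.
    rw [Ideal.subset_union_prime (maximalIdeal R ^ 2) (maximalIdeal R ^ 2)] at hcover
    · obtain ⟨I, hI, hle⟩ := hcover
      rcases Finset.mem_insert.mp hI with rfl | hI
      · exact hsq hle
      · have hI := hfin.mem_toFinset.mp hI
        have := hI.1.1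
        exact hmin (((maximalIdeal.isMaximal R).eq_of_le this.ne_top hle) ▸ hI)
    · intro I hI hne _
      exact (hfin.mem_toFinset.mp ((Finset.mem_insert.mp hI).resolve_left hne)).1.1
  have := quotient_span_singleton hx hx'
  have hdom := ih _ (h ▸ Nat.lt_of_succ_le
    (spanFinrank_maximalIdeal_quotient_add_one_le hx hx')) (R ⧸ Ideal.span {x}) rfl
  have hprime : (Ideal.span {x}).IsPrime := (Ideal.Quotient.isDomain_iff_prime _).mp hdom
  obtain ⟨p, hp, hpx⟩ := Ideal.exists_minimalPrimes_le (bot_le (a := Ideal.span {x}))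
  have hpprime : p.IsPrime := hp.1.1
  have hpbot : p = ⊥ := by
    -- As `p` lies in `(x)` but omits `x`, it equals `x p`; Nakayama applies.
    refine Submodule.eq_bot_of_le_smul_of_le_jacobson_bot (Ideal.span {x}) _
      p.fg_of_isNoetherianRing (fun a ha ↦ ?_)
      (((Ideal.span_singleton_le_iff_mem _).mpr hx).trans (maximalIdeal_le_jacobson _))
    obtain ⟨b, rfl⟩ := Ideal.mem_span_singleton'.mp (hpx ha)
    rw [mul_comm, smul_eq_mul]
    exact Ideal.mul_mem_mul (Ideal.mem_span_singleton_self x)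
      ((hpprime.mem_or_mem ha).resolve_right (hxmin p hp))
  have : (⊥ : Ideal R).IsPrime := hpbot ▸ hpprime
  exact IsDomain.of_bot_isPrime R

end IsRegularLocalRing

/-- If `y` is a nonzerodivisor in the maximal ideal of a Noetherian local `A`-algebra `B` and
`B / yB` is flat over `A`, then `B` is flat over `A`. -/
theorem Module.Flat.of_flat_quotient_span_singleton {A B : Type*} [CommRing A] [CommRing B]
    [IsLocalRing B] [IsNoetherianRing B] [Algebra A B] {y : B} (hy : y ∈ maximalIdeal B)
    (hreg : y ∈ nonZeroDivisors B) [Module.Flat A (B ⧸ Ideal.span {y})] : Module.Flat A B := by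
  rw [Module.Flat.iff_lTensor_injective]
  intro I hI
  have : Module.Finite A I := Module.Finite.iff_fg.mpr hI
  let φ : B ⊗[A] I →ₗ[B] B ⊗[A] A := AlgebraTensorModule.lTensor B B I.subtype
  let f : B →ₗ[A] B := LinearMap.mulLeft A y
  let g : B →ₗ[A] (B ⧸ Ideal.span {y}) := (Ideal.Quotient.mkₐ A (Ideal.span {y})).toLinearMap
  have hfg : Function.Exact f g := fun b ↦ by
    simp [f, g, Ideal.Quotient.eq_zero_iff_mem, Ideal.mem_span_singleton', mul_comm]
  have hf (z : B ⊗[A] I) : f.rTensor I z = y • z := by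
    induction z with
    | zero => simp
    | tmul a b => simp [f, smul_tmul']
    | add a b ha hb => rw [map_add, ha, hb, smul_add]
  -- Flatness of B/yB puts the kernel K in y(B ⊗ I); regularity of y on B then gives K = yK.
  have hK : LinearMap.ker φ = ⊥ := by
    refine Submodule.eq_bot_of_le_smul_of_le_jacobson_bot (Ideal.span {y}) _
      (IsNoetherian.noetherian _) (fun z hz ↦ ?_)
      (((Ideal.span_singleton_le_iff_mem _).mpr hy).trans (maximalIdeal_le_jacobson _))
    have hz' : I.subtype.lTensor B z = 0 := hz
    have hgz : g.rTensor I z = 0 := by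
      apply Module.Flat.lTensor_preserves_injective_linearMap (M := B ⧸ Ideal.span {y})
        I.subtype I.subtype_injective
      rw [map_zero, ← LinearMap.comp_apply, LinearMap.lTensor_comp_rTensor,
        ← LinearMap.rTensor_comp_lTensor, LinearMap.comp_apply, hz', map_zero]
    obtain ⟨w, rfl⟩ := (_root_.rTensor_exact I hfg Ideal.Quotient.mk_surjective z).mp hgz
    rw [hf] at hz ⊢
    refine Submodule.smul_mem_smul (Ideal.mem_span_singleton_self y) ?_
    rw [LinearMap.mem_ker, map_smul] at hz
    rw [LinearMap.mem_ker]
    apply (AlgebraTensorModule.rid A B B).injective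
    have := congrArg (AlgebraTensorModule.rid A B B) hz
    rw [map_smul, map_zero, smul_eq_mul] at this
    rw [map_zero]
    exact (mul_left_mem_nonZeroDivisors_eq_zero_iff hreg).mp this
  exact (LinearMap.ker_eq_bot (f := φ)).mp hK

/-- If an algebra augmentation of a Noetherian local ring has nonzero kernel, then that kernel
contains an element outside the square of the maximal ideal. -/
lemma IsLocalRing.exists_mem_ker_notMem_sq {A B : Type*} [CommRing A] [CommRing B]
    [IsLocalRing B] [IsNoetherianRing B] [Algebra A B] (p : B →ₐ[A] A)
    (hp : RingHom.ker p ≠ ⊥) :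
    ∃ y ∈ RingHom.ker p, y ∈ maximalIdeal B ∧ y ∉ maximalIdeal B ^ 2 := by
  have : Nontrivial A := (algebraMap A B).domain_nontrivial
  have hle : RingHom.ker p ≤ maximalIdeal B := le_maximalIdeal (RingHom.ker_ne_top _)
  by_contra! hcon
  apply hp
  have hsub (b : B) : b - algebraMap A B (p b) ∈ RingHom.ker p := by
    simp [RingHom.mem_ker]
  have hmem {b : B} (hb : b ∈ maximalIdeal B) : algebraMap A B (p b) ∈ maximalIdeal B := by
    simpa using sub_mem hb (hle (hsub b))
  -- Modulo 𝔪P, `b ↦ b - p b` obeys a Leibniz-type rule, so it kills 𝔪². Hence P ≤ 𝔪² would force P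
  -- = 𝔪P.
  have hsq {z : B} (hz : z ∈ maximalIdeal B ^ 2) :
      z - algebraMap A B (p z) ∈ maximalIdeal B * RingHom.ker p := by
    rw [pow_two] at hz
    induction hz using Submodule.mul_induction_on' with
    | mem_mul_mem a ha b hb =>
      have : a * b - algebraMap A B (p (a * b)) =
          a * (b - algebraMap A B (p b)) +
            algebraMap A B (p b) * (a - algebraMap A B (p a)) := by
        rw [map_mul, map_mul]; ring
      rw [this]
      exact add_mem (Ideal.mul_mem_mul ha (hsub b)) (Ideal.mul_mem_mul (hmem hb) (hsub a))
    | add a _ b _ ha hb =>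
      rw [map_add, map_add, add_sub_add_comm]
      exact add_mem ha hb
  refine Submodule.eq_bot_of_le_smul_of_le_jacobson_bot (maximalIdeal B) _
    (Ideal.fg_of_isNoetherianRing _) (fun y hy ↦ ?_) (maximalIdeal_le_jacobson _)
  have := hsq (hcon y hy (hle hy))
  rwa [(RingHom.mem_ker).mp hy, map_zero, sub_zero] at this

/-- A regular local ring is flat over each of its algebra retracts. -/
theorem IsRegularLocalRing.flat_of_algHom {A : Type*} [CommRing A] (B : Type*) [CommRing B]
    [IsRegularLocalRing B] [Algebra A B] (p : B →ₐ[A] A) : Module.Flat A B := by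
  induction h : (maximalIdeal B).spanFinrank using Nat.strong_induction_on generalizing B with
  | _ n ih =>
  by_cases hp : RingHom.ker p = ⊥
  · have hinj : Function.Injective p := (RingHom.injective_iff_ker_eq_bot p).mpr hp
    have hsurj : Function.Surjective p := fun a ↦ ⟨algebraMap A B a, by simp⟩
    exact Module.Flat.of_linearEquiv (AlgEquiv.ofBijective p ⟨hinj, hsurj⟩).toLinearEquiv
  obtain ⟨y, hyp, hy, hy'⟩ := IsLocalRing.exists_mem_ker_notMem_sq p hp
  have := quotient_span_singleton hy hy'
  have := isDomain B
  have hy0 : y ≠ 0 := fun h ↦ hy' (h ▸ zero_mem _)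
  have := ih _ (h ▸ Nat.lt_of_succ_le (spanFinrank_maximalIdeal_quotient_add_one_le hy hy'))
    (B ⧸ Ideal.span {y})
    (Ideal.Quotient.liftₐ _ p fun b hb ↦ (Ideal.span_singleton_le_iff_mem _).mpr hyp hb) rfl
  exact Module.Flat.of_flat_quotient_span_singleton hy (mem_nonZeroDivisors_of_ne_zero hy0)

/-- A ring homomorphism into a regular local ring which admits a left inverse is faithfully
flat. -/
theorem IsRegularLocalRing.faithfullyFlat_of_comp_eq_id {A B : Type*} [CommRing A] [CommRing B]
    [IsRegularLocalRing B] (i : A →+* B) (p : B →+* A) (hpi : p.comp i = RingHom.id A) :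
    i.FaithfullyFlat := by
  algebraize [i]
  have hpi' (a : A) : p (i a) = a := RingHom.congr_fun hpi a
  have := flat_of_algHom B ({ p with commutes' := hpi' } : B →ₐ[A] A)
  rw [RingHom.FaithfullyFlat.iff_flat_and_comap_surjective]
  refine ⟨‹_›, fun q ↦ ⟨PrimeSpectrum.comap p q, ?_⟩⟩
  rw [← PrimeSpectrum.comap_comp_apply, hpi]
  rfl

namespace IsRetraction

variable {B : Type*} [CommRing B] {π : B →+* B} {A : Subring B}

lemma mem (h : IsRetraction π A) (b : B) : π b ∈ A := h.range_eq ▸ π.mem_range_self b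

lemma apply_of_mem (h : IsRetraction π A) {a : B} (ha : a ∈ A) : π a = a := by
  obtain ⟨b, rfl⟩ := h.range_eq ▸ ha
  exact RingHom.congr_fun h.idempotent b

lemma codRestrict_comp_subtype (h : IsRetraction π A) :
    (π.codRestrict A h.mem).comp A.subtype = RingHom.id A :=
  RingHom.ext fun a ↦ Subtype.ext (h.apply_of_mem a.2)

end IsRetraction

theorem proposition6p8 :
    (∀ (B : Type*) [CommRing B] [IsRegularLocalRing B], IsEquicharacteristic B →
      ∀ A : Subring B, IsRetract A → Module.FaithfullyFlat A B) ∧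
    (∀ (k : Type*) [Field k] (n : ℕ) (A : Subring (MvPolynomial (Fin n) k))
      (π : MvPolynomial (Fin n) k →+* MvPolynomial (Fin n) k), IsRetraction π A →
      ∀ (m : Ideal (MvPolynomial (Fin n) k)) [m.IsMaximal], RingHom.ker π ≤ m →
        (Localization.localRingHom (m.comap A.subtype) m A.subtype rfl).FaithfullyFlat) := by
  refine ⟨fun B _ _ _ A ⟨π, hπ⟩ ↦ ?_, fun k _ n A π hπ m _ hm ↦ ?_⟩
  · exact RingHom.faithfullyFlat_algebraMap_iff.mp
      (IsRegularLocalRing.faithfullyFlat_of_comp_eq_id A.subtype _ hπ.codRestrict_comp_subtype)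
  -- `b` and `π b` differ by an element of ker π ≤ m, so m is recovered from its contraction to A.
  · have hcomap : m = (m.comap A.subtype).comap (π.codRestrict A hπ.mem) := by
      ext b
      have hb : b - π b ∈ m := hm <| by
        rw [RingHom.mem_ker, map_sub, hπ.apply_of_mem (hπ.mem b), sub_self]
      exact (Submodule.sub_mem_iff_left m hb).symm.trans (by simp)
    refine IsRegularLocalRing.faithfullyFlat_of_comp_eq_id _
      (Localization.localRingHom m (m.comap A.subtype) (π.codRestrict A hπ.mem) hcomap) ?_
    rw [← Localization.localRingHom_comp]
    refine Localization.localRingHom_unique _ _ _ _ fun a ↦ ?_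
    rw [hπ.codRestrict_comp_subtype]
    rfl
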